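/- Let $k\ge 2$. A $k$-DFAO $M$ is a finite automaton with states $0,\dots,n-1$, a start state, a transition function on the input letters $0,\dots,k-1$, and an output letter attached to each state. It generates the infinite word ${\bf x}=x_0x_1x_2\cdots$ in which $x_i$ is the output of the state reached from the start state on reading the base-$k$ representation of $i$ (most significant digit first, without leading zeros, the representation of $0$ being empty). The words generated in this way are the $k$-automatic words. A nonempty finite word $w$ is primitive if it is not of the form $u^e$ with $e\ge 2$, and $w$ is of unbounded exponent in ${\bf x}$ if $w^e$ is a factor of ${\bf x}$ for arbitrarily large integers $e$. Then every $k$-automatic word ${\bf x}$ has only finitely many primitive factors of unbounded exponent in ${\bf x}$, and they can be determined explicitly: for every effectively coded output alphabet (for instance any finite alphabet, or $\mathbb{N}$) there is an algorithm (a total computable function) that, given $k\ge 2$ and the table (start state, transitions and outputs) of a $k$-DFAO generating ${\bf x}$, outputs a finite list whose entries are exactly the primitive factors $w$ of ${\bf x}$ that are of unbounded exponent in ${\bf x}$. -/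

import Mathlib

/-- A deterministic automaton with output (DFAO): input letters `κ`, states `σ`,
output letters `α`. -/
structure DFAO (κ σ α : Type*) where
  step : σ → κ → σ
  start : σ
  out : σ → α

namespace DFAO

/-- The output of the automaton after reading the input `u` from left to right. -/
def output {κ σ α : Type*} (M : DFAO κ σ α) (u : List κ) : α :=
  M.out (u.foldl M.step M.start)

/-- The explicit finite description of a DFAO with input letters `0, …, k - 1` and states
`0, …, n - 1`: the start state, and for each state in turn the row of its `k` successor states
together with its output letter. -/
def table {k n : ℕ} {α : Type*} (M : DFAO (Fin k) (Fin n) α) : ℕ × List (List ℕ × α) :=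
  ((M.start : ℕ),
    List.ofFn fun q : Fin n => (List.ofFn fun d : Fin k => (M.step q d : ℕ), M.out q))

end DFAO

/-- The canonical base-`k` representation of `n`, most significant digit first, without leading
zeros; the representation of `0` is the empty word. -/
def baseRep (k : ℕ) (hk : 2 ≤ k) (n : ℕ) : List (Fin k) :=
  ((Nat.digits k n).pmap Fin.mk fun _ hd => Nat.digits_lt_base hk hd).reverse

/-- The automaton `M` generates the infinite word `x`: on the base-`k` representation of `i` it
outputs the letter `x i`. A word is `k`-automatic if it is generated by some DFAO with finitely
many states. -/
def DFAO.Generates {k n : ℕ} {α : Type*} (hk : 2 ≤ k) (M : DFAO (Fin k) (Fin n) α)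
    (x : ℕ → α) : Prop :=
  ∀ i, x i = M.output (baseRep k hk i)

/-- The length-`n` word `x[i..i+n-1]`. -/
def infWordSlice {α : Type*} (x : ℕ → α) (i n : ℕ) : List α :=
  (List.range n).map fun j => x (i + j)

/-- The set of all finite factors of the infinite word `x`. -/
def infWordFac {α : Type*} (x : ℕ → α) : Set (List α) :=
  {w | ∃ i n, w = infWordSlice x i n}

/-- The power `w ^ e` of a finite word. -/
def wordPow {α : Type*} (w : List α) (e : ℕ) : List α :=
  (List.replicate e w).flatten

/-- A finite nonempty word is primitive if it is not a power `u ^ e` with `e ≥ 2`. -/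
def IsPrimitiveWord {α : Type*} (w : List α) : Prop :=
  w ≠ [] ∧ ¬ ∃ (u : List α) (e : ℕ), 2 ≤ e ∧ w = wordPow u e

/-- Arbitrarily large powers of `w` are factors of `x`. -/
def HasUnboundedExponent {α : Type*} (w : List α) (x : ℕ → α) : Prop :=
  ∀ N : ℕ, ∃ e, N ≤ e ∧ wordPow w e ∈ infWordFac x

/-- The primitive factors of `x` that are of unbounded exponent in `x`. -/
def primitiveUnbounded {α : Type*} (x : ℕ → α) : Set (List α) :=
  {w | w ∈ infWordFac x ∧ IsPrimitiveWord w ∧ HasUnboundedExponent w x}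

/-! The word `x` is a coding of states `q`, where the state at `a` determines the states at `k * a +
d` for `d < k`, hence for every `m` the aligned block of length `k ^ m` with index `a` (its
level-`m` block). A word `w` has unbounded exponent iff at every level some aligned block runs along
the cyclic word of `w`. Which pairs of states have equal level-`m` blocks, and which states carry a
cyclic block with which phase, is finite data evolving deterministically in `m` (for phases,
together with `k ^ m` modulo the length), so it is eventually periodic.

The crux is `le_of_forall_exists_isCyclicBlock`, which bounds the length `p` of a primitive `w`. By
periodicity of states, one run of siblings carries cyclic blocks both of a high level `m` and of a
bounded level `c`. Two of the first `N + 1` siblings share a state, `N` being the number of states,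
so primitivity makes the long blocks repeat with some step `d + 1 ≤ N`. Periodicity of block
equality passes this repetition to level `c`, whence `p ∣ k ^ c * (d + 1)`.

With `p` bounded, `exists_isCyclicBlock_of_large` replaces unbounded exponent by one fixed large
exponent, and `IsUniformStates.exists_lt` bounds where the power occurs. Membership is thus a
bounded search, primitive recursive in `k` and the table. -/

/-- A sequence in a finite type in which each term determines the next is eventually periodic. -/
theorem exists_period_of_deterministic {X : Type*} [Finite X] (s : ℕ → X)
    (hs : ∀ m m', s m = s m' → s (m + 1) = s (m' + 1)) :
    ∃ a D, 0 < D ∧ a + D ≤ Nat.card X ∧ ∀ m, a ≤ m → ∀ j, s (m + j * D) = s m := by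
  obtain ⟨a, b, hab, hb, h⟩ : ∃ a b, a < b ∧ b ≤ Nat.card X ∧ s a = s b := by
    have := Fintype.ofFinite X
    obtain ⟨i, j, hij, h⟩ := Fintype.exists_ne_map_eq_of_card_lt
      (fun i : Fin (Nat.card X + 1) => s i) (by simp [Nat.card_eq_fintype_card])
    rcases lt_or_gt_of_ne hij with hlt | hlt
    · exact ⟨i, j, hlt, by omega, h⟩
    · exact ⟨j, i, hlt, by omega, h.symm⟩
  have shift : ∀ t, s (a + t) = s (b + t) := by
    intro t
    induction t with
    | zero => exact h
    | succ t ih => exact hs _ _ ih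
  refine ⟨a, b - a, by omega, by omega, fun m hm j => ?_⟩
  induction j with
  | zero => simp
  | succ j ih =>
    rw [← ih]
    have := shift (m - a + j * (b - a))
    rw [show a + (m - a + j * (b - a)) = m + j * (b - a) by omega] at this
    rw [this, Nat.succ_mul]
    congr 1
    omega

/-! ### Aligned blocks and their periodicity in the level -/

section Blocks

variable {Q α : Type*} {k : ℕ} {q : ℕ → Q} {x : ℕ → α}

/-- The state at an index determines the states at the children of that index. -/
def IsUniformStates (k : ℕ) (q : ℕ → Q) : Prop :=
  ∀ a b, q a = q b → ∀ d < k, q (k * a + d) = q (k * b + d)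

/-- The aligned blocks of length `k ^ m` with indices `a` and `b` are equal. -/
def EqBlock (x : ℕ → α) (k m a b : ℕ) : Prop :=
  ∀ r < k ^ m, x (k ^ m * a + r) = x (k ^ m * b + r)

/-- The aligned block of length `k ^ m` with index `a` is read along the cyclic word `W`,
starting at phase `g`. -/
def IsCyclicBlock {p : ℕ} (x : ℕ → α) (k : ℕ) (W : ZMod p → α) (m a : ℕ) (g : ZMod p) : Prop :=
  ∀ r < k ^ m, x (k ^ m * a + r) = W (g + r)

theorem IsUniformStates.descendants (hq : IsUniformStates k q) {a b : ℕ} (h : q a = q b) (m : ℕ) :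
    EqBlock q k m a b := by
  induction m with
  | zero =>
    intro r hr
    obtain rfl : r = 0 := by simpa using hr
    simpa using h
  | succ m ih =>
    intro r hr
    have hk : 0 < k := by
      rcases Nat.eq_zero_or_pos k with rfl | hk
      · simp at hr
      · exact hk
    have e : ∀ c, k ^ (m + 1) * c + r = k * (k ^ m * c + r / k) + r % k := by
      intro c
      conv_lhs => rw [← Nat.div_add_mod r k]
      ring
    rw [e, e]
    refine hq _ _ (ih _ ?_) _ (Nat.mod_lt _ hk)
    rw [Nat.div_lt_iff_lt_mul hk, ← pow_succ]
    exact hr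

theorem IsUniformStates.eqBlock (hq : IsUniformStates k q) (hx : ∀ a b, q a = q b → x a = x b)
    {a b : ℕ} (h : q a = q b) (m : ℕ) : EqBlock x k m a b :=
  fun r hr => hx _ _ (hq.descendants h m r hr)

/-- Every state occurs at an index below `k ^ card Q`. -/
theorem IsUniformStates.exists_lt [Finite Q] (hk : 2 ≤ k) (hq : IsUniformStates k q) (a : ℕ) :
    ∃ b < k ^ Nat.card Q, q b = q a := by
  classical
  have hex : ∃ b, q b = q a := ⟨a, rfl⟩
  refine ⟨Nat.find hex, ?_, Nat.find_spec hex⟩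
  by_contra! hb
  set b := Nat.find hex with hbdef
  -- Two prefixes of the digits of `b` lead to the same state; replacing the longer by the shorter
  -- gives a smaller index with the state of `b`.
  obtain ⟨s, t, hst, ht, h⟩ : ∃ s t, s < t ∧ t ≤ Nat.card Q ∧ q (b / k ^ s) = q (b / k ^ t) := by
    have := Fintype.ofFinite Q
    obtain ⟨i, j, hij, h⟩ := Fintype.exists_ne_map_eq_of_card_lt
      (fun i : Fin (Nat.card Q + 1) => q (b / k ^ (i : ℕ))) (by simp [Nat.card_eq_fintype_card])
    rcases lt_or_gt_of_ne hij with hlt | hlt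
    · exact ⟨i, j, hlt, by omega, h⟩
    · exact ⟨j, i, hlt, by omega, h.symm⟩
  have hpos : 0 < k ^ s := by positivity
  have hs1 : 0 < b / k ^ s :=
    Nat.div_pos ((Nat.pow_le_pow_right (by omega) (by omega)).trans hb) hpos
  have hlt : b / k ^ t < b / k ^ s := by
    obtain ⟨u, rfl⟩ := Nat.exists_eq_add_of_lt hst
    rw [show s + u + 1 = s + (u + 1) by ring, pow_add, ← Nat.div_div_eq_div_mul]
    exact Nat.div_lt_self hs1 (Nat.one_lt_pow (by omega) (by omega))
  have hmod := Nat.mod_lt b hpos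
  have hq' := hq.descendants h s _ hmod
  rw [Nat.div_add_mod] at hq'
  have hmin : k ^ s * (b / k ^ t) + b % k ^ s < b := by
    conv_rhs => rw [← Nat.div_add_mod b (k ^ s)]
    gcongr
  exact Nat.find_min hex hmin (hq'.symm.trans (Nat.find_spec hex))

/-- A block is the concatenation of the blocks of its children, so block equality at one level
determines it at the next. -/
theorem eqBlock_succ (hk : 0 < k) (m a b : ℕ) :
    EqBlock x k (m + 1) a b ↔ ∀ d < k, EqBlock x k m (k * a + d) (k * b + d) := by
  constructor
  · intro h d hd r hr
    have := h (k ^ m * d + r) (by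
      calc k ^ m * d + r < k ^ m * (d + 1) := by rw [mul_add]; omega
        _ ≤ k ^ m * k := by gcongr; omega
        _ = k ^ (m + 1) := by ring)
    convert this using 2 <;> ring
  · intro h r hr
    have hr' : r / k ^ m < k := by
      rw [Nat.div_lt_iff_lt_mul (by positivity), mul_comm, ← pow_succ]
      exact hr
    have := h _ hr' (r % k ^ m) (Nat.mod_lt _ (by positivity))
    have e := Nat.div_add_mod r (k ^ m)
    convert this using 2
    · conv_lhs => rw [← e]
      ring
    · conv_lhs => rw [← e]
      ring

/-- The `i`-th sub-block of level `m` begins `k ^ m * i` letters into the large block, which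
accounts for its phase. -/
theorem isCyclicBlock_add {p : ℕ} {W : ZMod p → α} (hk : 0 < k) (m j a : ℕ) (g : ZMod p) :
    IsCyclicBlock x k W (m + j) a g ↔
      ∀ i < k ^ j, IsCyclicBlock x k W m (k ^ j * a + i) (g + (k : ZMod p) ^ m * i) := by
  constructor
  · intro h i hi r hr
    have := h (k ^ m * i + r) (by
      calc k ^ m * i + r < k ^ m * (i + 1) := by rw [mul_add]; omega
        _ ≤ k ^ m * k ^ j := by gcongr; omega
        _ = k ^ (m + j) := by ring)
    convert this using 2
    · ring
    · push_cast
      ring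
  · intro h r hr
    have hr' : r / k ^ m < k ^ j := by
      rw [Nat.div_lt_iff_lt_mul (by positivity), mul_comm, ← pow_add]
      exact hr
    have := h _ hr' (r % k ^ m) (Nat.mod_lt _ (by positivity))
    have e := Nat.div_add_mod r (k ^ m)
    convert this using 2
    · conv_lhs => rw [← e]
      ring
    · conv_lhs => rw [← e]
      push_cast
      ring

theorem IsCyclicBlock.zero_child {p : ℕ} {W : ZMod p → α} (hk : 0 < k) {m j a : ℕ} {g : ZMod p}
    (h : IsCyclicBlock x k W (m + j) a g) : IsCyclicBlock x k W m (k ^ j * a) g := by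
  simpa using (isCyclicBlock_add hk m j a g).1 h 0 (by positivity)

theorem IsCyclicBlock.congr {p : ℕ} {W : ZMod p → α} {m a b : ℕ} {g : ZMod p}
    (h : IsCyclicBlock x k W m a g) (hab : EqBlock x k m a b) : IsCyclicBlock x k W m b g :=
  fun r hr => (hab r hr).symm.trans (h r hr)

/-- A cyclic factor of length `2 * k ^ m` contains an aligned block of length `k ^ m`. -/
theorem exists_isCyclicBlock {p : ℕ} {W : ZMod p → α} (hk : 0 < k) (m i : ℕ)
    (h : ∀ t < 2 * k ^ m, x (i + t) = W t) : ∃ a g, IsCyclicBlock x k W m a g := by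
  have hpos : 0 < k ^ m := by positivity
  have hmod := Nat.mod_lt i hpos
  have e := Nat.div_add_mod i (k ^ m)
  generalize i % k ^ m = ρ at hmod e
  refine ⟨i / k ^ m + 1, ((k ^ m - ρ : ℕ) : ZMod p), fun r hr => ?_⟩
  have := h (k ^ m - ρ + r) (by omega)
  rw [Nat.cast_add] at this
  rw [← this, mul_add]
  congr 1
  omega

/-- If there is a sufficiently long aligned cyclic block, there are arbitrarily long ones. -/
theorem exists_isCyclicBlock_of_large [Finite Q] (hk : 0 < k) (hq : IsUniformStates k q)
    (hx : ∀ a b, q a = q b → x a = x b) {p : ℕ} [NeZero p] {W : ZMod p → α} {M : ℕ}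
    (hM : 2 ^ (Nat.card Q * p) * p ≤ M) (h : ∃ a g, IsCyclicBlock x k W M a g) (m : ℕ) :
    ∃ a g, IsCyclicBlock x k W m a g := by
  -- The phases of the children involve `k ^ m` modulo `p`; without this residue the sequence would
  -- not be deterministic.
  let s : ℕ → (Q × ZMod p → Prop) × ZMod p := fun m =>
    (fun c => ∃ a, q a = c.1 ∧ IsCyclicBlock x k W m a c.2, (k : ZMod p) ^ m)
  have hs_apply : ∀ m a g, (s m).1 (q a, g) ↔ IsCyclicBlock x k W m a g := fun m a g =>
    ⟨fun ⟨b, hb, hblk⟩ => hblk.congr (hq.eqBlock hx hb m), fun hblk => ⟨a, rfl, hblk⟩⟩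
  have hs : ∀ m m', s m = s m' → s (m + 1) = s (m' + 1) := by
    intro m m' hmm
    have h2 : (k : ZMod p) ^ m = (k : ZMod p) ^ m' := congrArg Prod.snd hmm
    have h1 : ∀ a g, IsCyclicBlock x k W m a g ↔ IsCyclicBlock x k W m' a g := fun a g => by
      rw [← hs_apply, ← hs_apply, hmm]
    refine Prod.ext (funext fun c => propext (exists_congr fun a => and_congr_right fun _ => ?_)) ?_
    · rw [isCyclicBlock_add hk, isCyclicBlock_add hk, h2]
      exact forall₂_congr fun i _ => h1 _ _
    · change (k : ZMod p) ^ (m + 1) = (k : ZMod p) ^ (m' + 1)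
      rw [pow_succ, pow_succ, h2]
  obtain ⟨a, D, hD, haD, hper⟩ := exists_period_of_deterministic s hs
  have hcard : Nat.card ((Q × ZMod p → Prop) × ZMod p) = 2 ^ (Nat.card Q * p) * p := by
    simp [Nat.card_prod, Nat.card_fun]
  rw [hcard] at haD
  obtain ⟨b, g, hb⟩ := h
  -- Descend from level `M` to the preperiod `a`, jump by periodicity to level `a + m * D`, and
  -- descend to `m`.
  obtain ⟨u, rfl⟩ := Nat.exists_eq_add_of_le (show a ≤ M by omega)
  have hbase := (hs_apply _ _ _).2 (hb.zero_child hk)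
  rw [← hper a le_rfl m, hs_apply] at hbase
  obtain ⟨v, hv⟩ := Nat.exists_eq_add_of_le
    (show m ≤ a + m * D from (Nat.le_mul_of_pos_right m hD).trans (Nat.le_add_left _ _))
  rw [hv] at hbase
  exact ⟨_, _, hbase.zero_child hk⟩

/-- Past a bounded level, equality of aligned blocks is periodic in the level. -/
theorem exists_eqBlock_period [Finite Q] (hk : 0 < k) (hq : IsUniformStates k q)
    (hx : ∀ a b, q a = q b → x a = x b) :
    ∃ c D, 0 < D ∧ c ≤ 2 ^ (Nat.card Q * Nat.card Q) ∧
      ∀ j a b, EqBlock x k (c + j * D) a b ↔ EqBlock x k c a b := by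
  let s : ℕ → (Q × Q → Prop) := fun m c => ∃ a b, q a = c.1 ∧ q b = c.2 ∧ EqBlock x k m a b
  have hs_apply : ∀ m a b, s m (q a, q b) ↔ EqBlock x k m a b := fun m a b =>
    ⟨fun ⟨a', b', ha, hb, h⟩ r hr => ((hq.eqBlock hx ha m r hr).symm.trans (h r hr)).trans
      (hq.eqBlock hx hb m r hr), fun h => ⟨a, b, rfl, rfl, h⟩⟩
  have hs : ∀ m m', s m = s m' → s (m + 1) = s (m' + 1) := by
    intro m m' hmm
    have h1 : ∀ a b, EqBlock x k m a b ↔ EqBlock x k m' a b := fun a b => by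
      rw [← hs_apply, ← hs_apply, hmm]
    refine funext fun c => propext (exists₂_congr fun a b => and_congr_right fun _ =>
      and_congr_right fun _ => ?_)
    rw [eqBlock_succ hk, eqBlock_succ hk]
    exact forall₂_congr fun i _ => h1 _ _
  obtain ⟨c, D, hD, hcD, hper⟩ := exists_period_of_deterministic s hs
  have hcard : Nat.card (Q × Q → Prop) = 2 ^ (Nat.card Q * Nat.card Q) := by
    simp [Nat.card_prod, Nat.card_fun]
  refine ⟨c, D, hD, by omega, fun j a b => ?_⟩
  rw [← hs_apply, ← hs_apply, hper c le_rfl]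

/-- The states at the indices `k ^ t * a` are periodic in `t`, with a period independent of `a`. -/
theorem IsUniformStates.pow_mul_period [Finite Q] (hk : 0 < k) (hq : IsUniformStates k q)
    (a j : ℕ) : q (k ^ (Nat.card Q + j * (Nat.card Q).factorial) * a) = q (k ^ Nat.card Q * a) := by
  obtain ⟨c, D, hD, hcD, hper⟩ := exists_period_of_deterministic (fun t => q (k ^ t * a))
    (fun m m' h => by
      have := hq _ _ h 0 hk
      simpa [pow_succ', mul_assoc] using this)
  obtain ⟨u, hu⟩ := Nat.dvd_factorial hD (show D ≤ Nat.card Q by omega)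
  have := hper (Nat.card Q) (by omega) (j * u)
  rw [hu]
  convert this using 4
  ring

/-- The length of a primitive cyclic word with arbitrarily long aligned blocks is bounded. -/
theorem le_of_forall_exists_isCyclicBlock [Finite Q] (hk : 2 ≤ k) (hq : IsUniformStates k q)
    (hx : ∀ a b, q a = q b → x a = x b) {p : ℕ} [NeZero p] {W : ZMod p → α}
    (hW : ∀ c, (∀ t, W (t + c) = W t) → c = 0)
    (h : ∀ m, ∃ a g, IsCyclicBlock x k W m a g) :
    p ≤ Nat.card Q * k ^ 2 ^ (Nat.card Q * Nat.card Q) := by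
  have hk0 : 0 < k := by omega
  set N := Nat.card Q with hN
  obtain ⟨c, D, hD, hc, hper⟩ := exists_eqBlock_period hk0 hq hx
  -- a phase shift that is invisible on a full period is trivial
  have phase : ∀ u v : ZMod p, (∀ t < p, W (u + (t : ℕ)) = W (v + (t : ℕ))) → u = v := by
    intro u v huv
    have := hW (u - v) fun t => by
      have := huv (t - v).val (ZMod.val_lt _)
      rw [ZMod.natCast_zmod_val] at this
      convert this using 2 <;> ring
    exact sub_eq_zero.1 this
  -- This leaves room among `k ^ J` siblings for the pigeonhole indices up to `N` and for `l + (d +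
  -- 1)` with `l < p`.
  set J := N + p + 1 with hJ
  -- The factor `p` makes level-`m` blocks longer than a period, `D` preserves block equality
  -- between levels `c` and `m`, and `N.factorial` makes the states at `k ^ N * A` and `k ^ (N + z)
  -- * A` agree.
  set z := p * D * N.factorial with hz
  set m := c + z with hm
  have hpz : p ≤ z := by
    rw [hz, mul_assoc]
    exact Nat.le_mul_of_pos_right _ (Nat.mul_pos hD (Nat.factorial_pos _))
  have hkJ : N + p + 1 < k ^ J := Nat.lt_pow_self (by omega)
  have hkm : p < k ^ m := by
    calc p ≤ m := by omega
      _ < k ^ m := Nat.lt_pow_self (by omega)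
  have hperm : ∀ a b, EqBlock x k m a b ↔ EqBlock x k c a b := by
    intro a b
    rw [← hper (p * N.factorial) a b, hm, hz]
    ring_nf
  obtain ⟨A, g, hA⟩ := h (m + J + N)
  -- Appending zeros keeps the phase `g`. Both descents end in the same state, so the same siblings
  -- carry level-`m` and level-`c` blocks.
  have h1 : IsCyclicBlock x k W (m + J) (k ^ N * A) g := hA.zero_child hk0
  have h0 : IsCyclicBlock x k W (c + J) (k ^ (N + z) * A) g := by
    rw [show m + J + N = c + J + (N + z) by omega] at hA
    exact hA.zero_child hk0
  have hqA : q (k ^ (N + z) * A) = q (k ^ N * A) := by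
    rw [hz]
    exact hq.pow_mul_period hk0 A (p * D)
  set A1 := k ^ N * A
  set A0 := k ^ (N + z) * A
  rw [isCyclicBlock_add hk0] at h1 h0
  replace h0 : ∀ i < k ^ J, IsCyclicBlock x k W c (k ^ J * A1 + i) (g + (k : ZMod p) ^ c * i) :=
    fun i hi => (h0 i hi).congr (hq.eqBlock hx (hq.descendants hqA J i hi) c)
  obtain ⟨i, i', hii, hi', hqi⟩ : ∃ i i', i < i' ∧ i' ≤ N ∧
      q (k ^ J * A1 + i) = q (k ^ J * A1 + i') := by
    have := Fintype.ofFinite Q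
    obtain ⟨i, j, hij, h⟩ := Fintype.exists_ne_map_eq_of_card_lt
      (fun i : Fin (N + 1) => q (k ^ J * A1 + i)) (by simp [hN, Nat.card_eq_fintype_card])
    rcases lt_or_gt_of_ne hij with hlt | hlt
    · exact ⟨i, j, hlt, by omega, h⟩
    · exact ⟨j, i, hlt, by omega, h.symm⟩
  obtain ⟨d, rfl⟩ := Nat.exists_eq_add_of_lt hii
  have hshift : (k : ZMod p) ^ m * ((d + 1 : ℕ) : ZMod p) = 0 := by
    have := phase (g + (k : ZMod p) ^ m * i) (g + (k : ZMod p) ^ m * (i + d + 1 : ℕ)) fun t ht => by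
      rw [← h1 i (by omega) t (by omega), ← h1 (i + d + 1) (by omega) t (by omega)]
      exact hq.eqBlock hx hqi m t (by omega)
    rw [add_right_inj, show i + d + 1 = i + (d + 1) by ring, Nat.cast_add i, mul_add] at this
    simpa using this
  -- The shift is known to vanish only at level `m`; `hperm` carries the resulting block equality
  -- down to level `c`.
  have hEq : ∀ l, l + (d + 1) < k ^ J →
      EqBlock x k c (k ^ J * A1 + l) (k ^ J * A1 + (l + (d + 1))) := by
    intro l hl
    rw [← hperm]
    intro r hr
    rw [h1 l (by omega) r hr, h1 _ hl r hr, Nat.cast_add l, mul_add, hshift, add_zero]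
  have hfin : (k : ZMod p) ^ c * ((d + 1 : ℕ) : ZMod p) = 0 := by
    have hpos : 0 < k ^ c := by positivity
    -- A single level-`c` block may be shorter than `p`, so a full period is covered by consecutive
    -- blocks, offset `t` lying in block `t / k ^ c`.
    have := phase g (g + (k : ZMod p) ^ c * (d + 1 : ℕ)) fun t ht => by
      have hl : t / k ^ c ≤ t := Nat.div_le_self _ _
      have hr := Nat.mod_lt t hpos
      have e := hEq (t / k ^ c) (by omega) _ hr
      rw [h0 _ (by omega) _ hr, h0 _ (by omega) _ hr] at e
      have ht' : (t : ZMod p) = (k : ZMod p) ^ c * (t / k ^ c : ℕ) + (t % k ^ c : ℕ) := by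
        conv_lhs => rw [← Nat.div_add_mod t (k ^ c)]
        push_cast
        ring
      rw [ht']
      convert e using 2
      · ring
      · push_cast
        ring
    simpa using this
  have hdvd : p ∣ k ^ c * (d + 1) := by
    rw [← ZMod.natCast_eq_zero_iff]
    push_cast
    push_cast at hfin
    exact hfin
  calc p ≤ k ^ c * (d + 1) := Nat.le_of_dvd (by positivity) hdvd
    _ ≤ k ^ 2 ^ (N * N) * N := by
      gcongr
      · omega
    _ = _ := mul_comm _ _

end Blocks

/-! ### Finite words as cyclic words -/

section Words

variable {α : Type*}

theorem wordPow_eq_map_range {w : List α} {p : ℕ} {f : ℕ → α} (hw : w = (List.range p).map f)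
    (hf : ∀ t, f (t + p) = f t) (e : ℕ) : wordPow w e = (List.range (e * p)).map f := by
  have hf' : ∀ e t, f (e * p + t) = f t := by
    intro e t
    induction e with
    | zero => simp
    | succ e ih => rw [← ih, ← hf (e * p + t)]; congr 1; ring
  induction e with
  | zero => simp [wordPow]
  | succ e ih =>
    rw [wordPow, List.replicate_succ', List.flatten_append, ← wordPow, ih, Nat.succ_mul,
      List.range_add, List.map_append, List.map_map, List.flatten_singleton]
    conv_lhs => rw [hw]
    congr 2
    funext t
    exact (hf' e t).symm

theorem infWordSlice_eq_map_range_iff {x f : ℕ → α} {i n m : ℕ} :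
    infWordSlice x i n = (List.range m).map f ↔ n = m ∧ ∀ t < m, x (i + t) = f t := by
  constructor
  · intro h
    have hl := congrArg List.length h
    simp only [infWordSlice, List.length_map, List.length_range] at hl
    subst hl
    refine ⟨rfl, fun t ht => ?_⟩
    simpa [infWordSlice, List.getElem?_range ht] using congrArg (·[t]?) h
  · rintro ⟨rfl, h⟩
    exact List.map_congr_left fun t ht => h t (List.mem_range.1 ht)

/-- A finite word of length `p` as a cyclic word indexed by `ZMod p`. -/
def cyclicWord (w : List α) [NeZero w.length] (z : ZMod w.length) : α :=
  w[z.val]'(ZMod.val_lt z)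

theorem eq_map_cyclicWord (w : List α) [NeZero w.length] :
    w = (List.range w.length).map fun t : ℕ => cyclicWord w t := by
  refine List.ext_getElem (by simp) fun t h _ => ?_
  simp [cyclicWord, Nat.mod_eq_of_lt h]

theorem wordPow_eq_map_cyclicWord (w : List α) [NeZero w.length] (e : ℕ) :
    wordPow w e = (List.range (e * w.length)).map fun t : ℕ => cyclicWord w t :=
  wordPow_eq_map_range (eq_map_cyclicWord w) (fun t => by simp) e

theorem wordPow_mem_infWordFac_iff {w : List α} [NeZero w.length] {x : ℕ → α} {e : ℕ} :
    wordPow w e ∈ infWordFac x ↔ ∃ i, ∀ t < e * w.length, x (i + t) = cyclicWord w t := by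
  rw [wordPow_eq_map_cyclicWord]
  constructor
  · rintro ⟨i, n, h⟩
    exact ⟨i, (infWordSlice_eq_map_range_iff.1 h.symm).2⟩
  · rintro ⟨i, h⟩
    exact ⟨i, _, (infWordSlice_eq_map_range_iff.2 ⟨rfl, h⟩).symm⟩

/-- A primitive word has no nontrivial cyclic symmetry. -/
theorem IsPrimitiveWord.eq_zero_of_shift {w : List α} [NeZero w.length] (hw : IsPrimitiveWord w)
    (c : ZMod w.length) (hc : ∀ t, cyclicWord w (t + c) = cyclicWord w t) : c = 0 := by
  by_contra hne
  have hmul : ∀ (z t : ZMod w.length), cyclicWord w (t + c * z) = cyclicWord w t := by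
    intro z
    rw [← ZMod.natCast_zmod_val z]
    induction z.val with
    | zero => simp
    | succ n ih =>
      intro t
      rw [Nat.cast_succ, mul_add, mul_one, ← add_assoc, hc, ih]
  -- By Bézout `d` is a multiple of `c` modulo the length, hence also a symmetry, and `w` is a power
  -- of its prefix of length `d`.
  set d := Nat.gcd c.val w.length with hd
  have hp : 0 < w.length := Nat.pos_of_ne_zero (NeZero.ne _)
  have hcpos : 0 < c.val := Nat.pos_of_ne_zero fun h => hne ((ZMod.val_eq_zero c).1 h)
  have hdlt : d < w.length := (Nat.gcd_le_left _ hcpos).trans_lt (ZMod.val_lt c)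
  obtain ⟨e, he⟩ : d ∣ w.length := Nat.gcd_dvd_right _ _
  have hdc : (d : ZMod w.length) = c * (Nat.gcdA c.val w.length : ZMod w.length) := by
    have := congrArg (Int.cast : ℤ → ZMod w.length) (Nat.gcd_eq_gcd_ab c.val w.length)
    simpa using this
  have htake : w.take d = (List.range d).map fun t : ℕ => cyclicWord w t := by
    conv_lhs => rw [eq_map_cyclicWord w]
    rw [← List.map_take, List.take_range, min_eq_left hdlt.le]
  refine hw.2 ⟨w.take d, e, ?_, ?_⟩
  · by_contra! h
    have : d * e ≤ d * 1 := Nat.mul_le_mul_left _ (by omega)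
    omega
  · rw [wordPow_eq_map_range htake (fun t => by rw [Nat.cast_add, hdc, hmul]), mul_comm, ← he]
    exact eq_map_cyclicWord w

/-- A root of `w` is a prefix of `w`, and its exponent is at most the length; primitivity thereby
becomes a bounded search. -/
theorem isPrimitiveWord_iff_bounded (w : List α) :
    IsPrimitiveWord w ↔ w ≠ [] ∧
      ¬ ∃ d < w.length, ∃ e < w.length + 1, 2 ≤ e ∧ w = wordPow (w.take d) e := by
  refine and_congr_right fun hne => not_congr ⟨?_, fun ⟨d, _, e, _, h⟩ => ⟨_, e, h⟩⟩
  rintro ⟨u, e, he, rfl⟩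
  have hl : (wordPow u e).length = e * u.length := by simp [wordPow]
  have hu : 0 < u.length := by
    rcases Nat.eq_zero_or_pos u.length with h | h
    · exact absurd (List.length_eq_zero_iff.1 (by simp [hl, h])) hne
    · exact h
  refine ⟨u.length, by rw [hl]; nlinarith, e, by rw [hl]; nlinarith, he, ?_⟩
  congr 1
  obtain ⟨e, rfl⟩ := Nat.exists_eq_add_of_le' (show 1 ≤ e by omega)
  simp [wordPow, List.replicate_succ]

end Words

/-! ### Reduction to a bounded search -/

section Decision

/-- A bound for the length of primitive words of unbounded exponent, for `N` states. -/
def lengthBound (k N : ℕ) : ℕ := N * k ^ 2 ^ (N * N)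

/-- A level from which on cyclic blocks of bounded period propagate to all levels. -/
def levelBound (k N : ℕ) : ℕ := 2 ^ (N * lengthBound k N) * lengthBound k N

/-- Words of bounded length with this exponent have unbounded exponent. -/
def exponentBound (k N : ℕ) : ℕ := 2 * k ^ levelBound k N

/-- A bound for the first occurrence of powers of words of unbounded exponent. -/
def positionBound (k N : ℕ) : ℕ := k ^ ((exponentBound k N + 1) * lengthBound k N + N)

variable {Q α : Type*} [Finite Q] {k : ℕ} {q : ℕ → Q} {x : ℕ → α}

/-- Skipping fewer than `w.length` letters brings the phase to `0`; the extra period in `e + 1` pays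
for this. -/
theorem IsCyclicBlock.exists_power {w : List α} [NeZero w.length] {m a e : ℕ} {g : ZMod w.length}
    (h : IsCyclicBlock x k (cyclicWord w) m a g) (he : (e + 1) * w.length ≤ k ^ m) :
    ∃ r < k ^ m, ∀ t < e * w.length, x (k ^ m * a + r + t) = cyclicWord w t := by
  have hlt := ZMod.val_lt (-g)
  rw [Nat.succ_mul] at he
  refine ⟨(-g).val, by omega, fun t ht => ?_⟩
  have := h ((-g).val + t) (by omega)
  rw [Nat.cast_add, ZMod.natCast_zmod_val, add_neg_cancel_left] at this
  rw [← this, add_assoc]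

theorem hasUnboundedExponent_iff (hk : 2 ≤ k) {w : List α} [NeZero w.length] :
    HasUnboundedExponent w x ↔ ∀ m, ∃ a g, IsCyclicBlock x k (cyclicWord w) m a g := by
  have hp : 0 < w.length := Nat.pos_of_ne_zero (NeZero.ne _)
  constructor
  · intro h m
    obtain ⟨e, he, hmem⟩ := h (2 * k ^ m)
    obtain ⟨i, hi⟩ := wordPow_mem_infWordFac_iff.1 hmem
    exact exists_isCyclicBlock (by omega) m i fun t ht =>
      hi t (ht.trans_le (he.trans (Nat.le_mul_of_pos_right _ hp)))
  · intro h e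
    obtain ⟨a, g, hb⟩ := h ((e + 1) * w.length)
    obtain ⟨r, -, hr⟩ := hb.exists_power (e := e) (Nat.lt_pow_self (by omega)).le
    exact ⟨e, le_rfl, wordPow_mem_infWordFac_iff.2 ⟨_, hr⟩⟩

/-- Membership in the set of primitive factors of unbounded exponent is a bounded condition. -/
theorem mem_primitiveUnbounded_iff (hk : 2 ≤ k) (hq : IsUniformStates k q)
    (hx : ∀ a b, q a = q b → x a = x b) (w : List α) :
    w ∈ primitiveUnbounded x ↔
      ∃ i < positionBound k (Nat.card Q), ∃ m < lengthBound k (Nat.card Q) + 1,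
        IsPrimitiveWord (infWordSlice x i m) ∧
        infWordSlice x i (exponentBound k (Nat.card Q) * m) =
          wordPow (infWordSlice x i m) (exponentBound k (Nat.card Q)) ∧
        infWordSlice x i m = w := by
  have hk0 : 0 < k := by omega
  set N := Nat.card Q
  have hE : 1 ≤ exponentBound k N := by
    have : 0 < k ^ levelBound k N := by positivity
    rw [exponentBound]
    omega
  constructor
  · rintro ⟨-, hprim, hunb⟩
    have : NeZero w.length := ⟨fun h => hprim.1 (List.length_eq_zero_iff.1 h)⟩
    rw [hasUnboundedExponent_iff hk] at hunb
    have hlen : w.length ≤ lengthBound k N :=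
      le_of_forall_exists_isCyclicBlock hk hq hx hprim.eq_zero_of_shift hunb
    -- As `k ^ L > L`, a block of this level `L` contains the required power; moving to an early
    -- index with the same state then bounds the position.
    obtain ⟨a', g, hb⟩ := hunb ((exponentBound k N + 1) * lengthBound k N)
    obtain ⟨a, ha, haq⟩ := hq.exists_lt hk a'
    obtain ⟨r, hr, hpow⟩ := (hb.congr (hq.eqBlock hx haq.symm _)).exists_power
      (e := exponentBound k N) ((Nat.mul_le_mul_left _ hlen).trans (Nat.lt_pow_self (by omega)).le)
    set L := (exponentBound k N + 1) * lengthBound k N with hL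
    have hslice : infWordSlice x (k ^ L * a + r) w.length = w := by
      conv_rhs => rw [eq_map_cyclicWord w]
      exact infWordSlice_eq_map_range_iff.2
        ⟨rfl, fun t ht => hpow t (ht.trans_le (Nat.le_mul_of_pos_left _ hE))⟩
    refine ⟨k ^ L * a + r, ?_, w.length, by omega, ?_⟩
    · calc k ^ L * a + r < k ^ L * (a + 1) := by rw [mul_add]; omega
        _ ≤ k ^ L * k ^ N := Nat.mul_le_mul_left _ ha
        _ = positionBound k N := by rw [positionBound, pow_add]
    · rw [hslice, wordPow_eq_map_cyclicWord]
      exact ⟨hprim, infWordSlice_eq_map_range_iff.2 ⟨rfl, hpow⟩, rfl⟩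
  · rintro ⟨i, -, m, hm, hprim, hpow, rfl⟩
    refine ⟨⟨i, m, rfl⟩, hprim, ?_⟩
    have hlen : (infWordSlice x i m).length = m := by simp [infWordSlice]
    have : NeZero (infWordSlice x i m).length :=
      ⟨fun h => hprim.1 (List.length_eq_zero_iff.1 h)⟩
    have hpos : 0 < (infWordSlice x i m).length := Nat.pos_of_ne_zero (NeZero.ne _)
    rw [wordPow_eq_map_cyclicWord, infWordSlice_eq_map_range_iff] at hpow
    rw [hasUnboundedExponent_iff hk]
    refine exists_isCyclicBlock_of_large (M := levelBound k N) hk0 hq hx ?_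
      (exists_isCyclicBlock hk0 _ i fun t ht =>
        hpow.2 t (ht.trans_le (Nat.le_mul_of_pos_right _ hpos)))
    have : (infWordSlice x i m).length ≤ lengthBound k N := by omega
    rw [levelBound]
    gcongr
    norm_num

end Decision

/-! ### The search carried out on a table -/

section Effective

variable {α : Type*}

/-- Successor state read off from a transition table. -/
def tableStep (rows : List (List ℕ × α)) (s d : ℕ) : ℕ :=
  (rows[s]?.bind fun r => r.1[d]?).getD 0

/-- The state reached on the base-`k` representation of `i`, read off from a base and a table. -/
def tableState (c : ℕ × (ℕ × List (List ℕ × α))) (i : ℕ) : ℕ :=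
  -- The case `c.1 < 2` only secures termination on inputs that are not valid bases.
  if _h : i = 0 ∨ c.1 < 2 then c.2.1
  else tableStep c.2.2 (tableState c (i / c.1)) (i % c.1)
termination_by i
decreasing_by exact Nat.div_lt_self (by omega) (by omega)

/-- The slice of the infinite word described by a base and a table. -/
def tableSlice (c : ℕ × (ℕ × List (List ℕ × α))) (i n : ℕ) : List α :=
  (List.range n).filterMap fun j => (c.2.2[tableState c (i + j)]?).map Prod.snd

open Classical in
/-- The list of the primitive factors of unbounded exponent, computed from a base and a table. -/
noncomputable def unboundedFactors (c : ℕ × (ℕ × List (List ℕ × α))) : List (List α) :=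
  ((List.range (positionBound c.1 (c.2.2.length + 1))).flatMap fun i =>
    (List.range (lengthBound c.1 (c.2.2.length + 1) + 1)).map fun m => (i, m)).filterMap fun v =>
      if IsPrimitiveWord (tableSlice c v.1 v.2) ∧
        tableSlice c v.1 (exponentBound c.1 (c.2.2.length + 1) * v.2) =
          wordPow (tableSlice c v.1 v.2) (exponentBound c.1 (c.2.2.length + 1))
      then some (tableSlice c v.1 v.2) else none

theorem mem_unboundedFactors_iff (c : ℕ × (ℕ × List (List ℕ × α))) (w : List α) :
    w ∈ unboundedFactors c ↔
      ∃ i < positionBound c.1 (c.2.2.length + 1), ∃ m < lengthBound c.1 (c.2.2.length + 1) + 1,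
        IsPrimitiveWord (tableSlice c i m) ∧
        tableSlice c i (exponentBound c.1 (c.2.2.length + 1) * m) =
          wordPow (tableSlice c i m) (exponentBound c.1 (c.2.2.length + 1)) ∧
        tableSlice c i m = w := by
  simp only [unboundedFactors, List.mem_filterMap, List.mem_flatMap, List.mem_map, List.mem_range]
  constructor
  · rintro ⟨_, ⟨i, hi, m, hm, rfl⟩, h⟩
    split_ifs at h with hc
    exact ⟨i, hi, m, hm, hc.1, hc.2, Option.some.inj h⟩
  · rintro ⟨i, hi, m, hm, h1, h2, rfl⟩
    exact ⟨(i, m), ⟨i, hi, m, hm, rfl⟩, if_pos ⟨h1, h2⟩⟩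

/-! ### Primitive recursiveness of the search -/

section Primrec

variable [Primcodable α]

theorem primrec_nat_pow : Primrec₂ fun a b : ℕ => a ^ b :=
  (Primrec.nat_rec' (f := fun v : ℕ × ℕ => v.2) (g := fun _ => 1) (h := fun v w => w.2 * v.1)
    Primrec.snd (Primrec.const 1)
    (Primrec.nat_mul.comp (Primrec.snd.comp Primrec.snd)
      (Primrec.fst.comp Primrec.fst)).to₂).of_eq fun v => by
    obtain ⟨a, b⟩ := v
    induction b with
    | zero => rfl
    | succ b ih => exact congrArg (· * a) ih

theorem primrec_lengthBound : Primrec₂ lengthBound :=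
  Primrec.nat_mul.comp .snd (primrec_nat_pow.comp .fst (primrec_nat_pow.comp (.const 2)
    (Primrec.nat_mul.comp .snd .snd)))

theorem primrec_levelBound : Primrec₂ levelBound :=
  Primrec.nat_mul.comp (primrec_nat_pow.comp (.const 2)
    (Primrec.nat_mul.comp .snd primrec_lengthBound)) primrec_lengthBound

theorem primrec_exponentBound : Primrec₂ exponentBound :=
  Primrec.nat_mul.comp (.const 2) (primrec_nat_pow.comp .fst primrec_levelBound)

theorem primrec_positionBound : Primrec₂ positionBound :=
  primrec_nat_pow.comp .fst (Primrec.nat_add.comp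
    (Primrec.nat_mul.comp (Primrec.succ.comp primrec_exponentBound) primrec_lengthBound) .snd)

theorem primrec_wordPow : Primrec₂ (wordPow : List α → ℕ → List α) :=
  (Primrec.list_flatMap (f := fun v : List α × ℕ => List.range v.2) (g := fun v _ => v.1)
    (Primrec.list_range.comp .snd) (Primrec.fst.comp .fst).to₂).of_eq fun v => by
      simp [wordPow, List.flatMap_def]

theorem primrecRel_exists_lt {β : Type*} [Primcodable β] {R : ℕ → β → Prop} (hR : PrimrecRel R) :
    PrimrecRel fun (n : ℕ) (y : β) => ∃ x < n, R x y :=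
  PrimrecPred.of_eq (hR.exists_mem_list.comp (Primrec.list_range.comp .fst) .snd) fun v => by simp

theorem primrecPred_isPrimitiveWord : PrimrecPred (IsPrimitiveWord : List α → Prop) := by
  have h1 : PrimrecRel fun (e : ℕ) (v : List α × ℕ) => 2 ≤ e ∧ v.1 = wordPow (v.1.take v.2) e :=
    PrimrecPred.and (Primrec.nat_le.comp (.const 2) .fst)
      (Primrec.eq.comp (Primrec.fst.comp .snd) (primrec_wordPow.comp
        (Primrec.list_take.comp (Primrec.snd.comp .snd) (Primrec.fst.comp .snd)) .fst))
  have h2 : PrimrecRel fun (d : ℕ) (w : List α) =>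
      ∃ e < w.length + 1, 2 ≤ e ∧ w = wordPow (w.take d) e :=
    PrimrecRel.comp (f := fun v : ℕ × List α => v.2.length + 1) (g := fun v => (v.2, v.1))
      (primrecRel_exists_lt h1) (Primrec.succ.comp (Primrec.list_length.comp .snd))
      (Primrec.pair .snd .fst)
  have h3 : PrimrecPred fun w : List α =>
      ∃ d < w.length, ∃ e < w.length + 1, 2 ≤ e ∧ w = wordPow (w.take d) e :=
    (primrecRel_exists_lt h2).comp Primrec.list_length Primrec.id
  exact ((Primrec.eq.comp Primrec.id (.const [])).not.and h3.not).of_eq fun w =>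
    (isPrimitiveWord_iff_bounded w).symm

theorem primrec_tableState :
    Primrec₂ (tableState : ℕ × (ℕ × List (List ℕ × α)) → ℕ → ℕ) := by
  -- For the strong recursion, `l` lists all earlier values, so `l.length` is the current index.
  let g : ℕ × (ℕ × List (List ℕ × α)) → List ℕ → Option ℕ := fun c l =>
    if l.length = 0 ∨ c.1 < 2 then some c.2.1
    else some (tableStep c.2.2 ((l[l.length / c.1]?).getD 0) (l.length % c.1))
  have hstep : Primrec fun v : List (List ℕ × α) × (ℕ × ℕ) => tableStep v.1 v.2.1 v.2.2 :=
    Primrec.option_getD.comp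
      (Primrec.option_bind
        (Primrec.list_getElem?.comp .fst (Primrec.fst.comp .snd))
        (Primrec.list_getElem?.comp (Primrec.fst.comp .snd)
          (Primrec.snd.comp (Primrec.snd.comp .fst))).to₂)
      (.const 0)
  have hlen : Primrec fun v : (ℕ × (ℕ × List (List ℕ × α))) × List ℕ => v.2.length :=
    Primrec.list_length.comp .snd
  have hbase : Primrec fun v : (ℕ × (ℕ × List (List ℕ × α))) × List ℕ => v.1.1 :=
    Primrec.fst.comp .fst
  have hg : Primrec₂ g := by
    refine Primrec.ite (PrimrecPred.or (Primrec.eq.comp hlen (.const 0))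
      (Primrec.nat_lt.comp hbase (.const 2)))
      (Primrec.option_some.comp (Primrec.fst.comp (Primrec.snd.comp .fst)))
      (Primrec.option_some.comp (hstep.comp (Primrec.pair
        (Primrec.snd.comp (Primrec.snd.comp .fst)) (Primrec.pair ?_ ?_))))
    · exact Primrec.option_getD.comp (Primrec.list_getElem?.comp .snd
        (Primrec.nat_div.comp hlen hbase)) (.const 0)
    · exact Primrec.nat_mod.comp hlen hbase
  refine Primrec.nat_strong_rec _ hg fun c i => ?_
  rw [tableState]
  simp only [g, List.length_map, List.length_range]
  split_ifs with h
  · rfl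
  · have : i / c.1 < i := Nat.div_lt_self (by omega) (by omega)
    simp [List.getElem?_range this]

theorem primrec_tableSlice :
    Primrec fun v : (ℕ × (ℕ × List (List ℕ × α))) × (ℕ × ℕ) => tableSlice v.1 v.2.1 v.2.2 :=
  Primrec.listFilterMap (Primrec.list_range.comp (Primrec.snd.comp .snd))
    (Primrec.option_map
      (Primrec.list_getElem?.comp (Primrec.snd.comp (Primrec.snd.comp (Primrec.fst.comp .fst)))
        (primrec_tableState.comp (Primrec.fst.comp .fst)
          (Primrec.nat_add.comp (Primrec.fst.comp (Primrec.snd.comp .fst)) .snd)))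
      (Primrec.snd.comp .snd).to₂).to₂

theorem primrec_unboundedFactors :
    Primrec (unboundedFactors : ℕ × (ℕ × List (List ℕ × α)) → List (List α)) := by
  classical
  have hN : Primrec fun c : ℕ × (ℕ × List (List ℕ × α)) => c.2.2.length + 1 :=
    Primrec.succ.comp (Primrec.list_length.comp (Primrec.snd.comp .snd))
  have hslice : Primrec fun v : (ℕ × (ℕ × List (List ℕ × α))) × (ℕ × ℕ) =>
      tableSlice v.1 v.2.1 v.2.2 := primrec_tableSlice
  have hE : Primrec fun v : (ℕ × (ℕ × List (List ℕ × α))) × (ℕ × ℕ) =>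
      exponentBound v.1.1 (v.1.2.2.length + 1) :=
    primrec_exponentBound.comp (Primrec.fst.comp .fst) (hN.comp .fst)
  refine Primrec.listFilterMap (Primrec.list_flatMap
    (Primrec.list_range.comp (primrec_positionBound.comp .fst hN))
    (Primrec.list_map (Primrec.list_range.comp (Primrec.succ.comp
      (primrec_lengthBound.comp (Primrec.fst.comp .fst) (hN.comp .fst))))
      (Primrec.pair (Primrec.snd.comp .fst) .snd).to₂).to₂) ?_
  refine Primrec.ite (PrimrecPred.and (primrecPred_isPrimitiveWord.comp hslice)
    (Primrec.eq.comp ?_ (primrec_wordPow.comp hslice hE)))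
    (Primrec.option_some.comp hslice) (.const none)
  exact hslice.comp (Primrec.pair .fst (Primrec.pair (Primrec.fst.comp .snd)
    (Primrec.nat_mul.comp hE (Primrec.snd.comp .snd))))

end Primrec

/-! ### Agreement of the table with the generated word -/

section Correctness

variable {k n : ℕ}

theorem baseRep_mul_add (hk : 2 ≤ k) (a d : ℕ) (hd : d < k) (hpos : 0 < k * a + d) :
    baseRep k hk (k * a + d) = baseRep k hk a ++ [⟨d, hd⟩] := by
  have h : Nat.digits k (k * a + d) = d :: Nat.digits k a := by
    rw [Nat.digits_def' (by omega) hpos, Nat.mul_add_mod, Nat.mod_eq_of_lt hd,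
      Nat.mul_add_div (by omega), Nat.div_eq_of_lt hd, add_zero]
  simp [baseRep, h]

/-- The state of `M` reached on the base-`k` representation of `i`. -/
def DFAO.stateAt {α : Type*} (M : DFAO (Fin k) (Fin n) α) (hk : 2 ≤ k) (i : ℕ) : Fin n :=
  (baseRep k hk i).foldl M.step M.start

theorem DFAO.stateAt_zero (M : DFAO (Fin k) (Fin n) α) (hk : 2 ≤ k) :
    M.stateAt hk 0 = M.start := by
  simp [DFAO.stateAt, baseRep]

theorem DFAO.stateAt_mul_add (M : DFAO (Fin k) (Fin n) α) (hk : 2 ≤ k) (a d : ℕ) (hd : d < k)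
    (hpos : 0 < k * a + d) :
    M.stateAt hk (k * a + d) = M.step (M.stateAt hk a) ⟨d, hd⟩ := by
  simp [DFAO.stateAt, baseRep_mul_add hk a d hd hpos]

/-- The states along the infinite word, with a separate state at index `0`. -/
def DFAO.uniformState (M : DFAO (Fin k) (Fin n) α) (hk : 2 ≤ k) (i : ℕ) : Option (Fin n) :=
  if i = 0 then none else some (M.stateAt hk i)

theorem DFAO.stateAt_eq_of_uniformState_eq (M : DFAO (Fin k) (Fin n) α) (hk : 2 ≤ k) {a b : ℕ}
    (h : M.uniformState hk a = M.uniformState hk b) :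
    (a = 0 ↔ b = 0) ∧ M.stateAt hk a = M.stateAt hk b := by
  unfold DFAO.uniformState at h
  split_ifs at h with ha hb hb
  · simp [ha, hb]
  · exact ⟨by simp [ha, hb], Option.some.inj h⟩

/-- Index `0` is its own child under digit `0`, whereas `M.step` may move the start state on reading
`0`. The extra state `none` removes this conflict and is the `+ 1` in `unboundedFactors`. -/
theorem DFAO.isUniformStates (M : DFAO (Fin k) (Fin n) α) (hk : 2 ≤ k) :
    IsUniformStates k (M.uniformState hk) := by
  intro a b h d hd
  obtain ⟨h0, hs⟩ := M.stateAt_eq_of_uniformState_eq hk h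
  have hz : ∀ c, k * c + d = 0 ↔ c = 0 ∧ d = 0 := fun c => by
    simp [show k ≠ 0 by omega]
  by_cases ha : k * a + d = 0
  · have hb : k * b + d = 0 := by rw [hz, ← h0, ← hz]; exact ha
    rw [ha, hb]
  · have hb : k * b + d ≠ 0 := by rw [Ne, hz, ← h0, ← hz]; exact ha
    rw [uniformState, uniformState, if_neg ha, if_neg hb,
      M.stateAt_mul_add hk a d hd (Nat.pos_of_ne_zero ha),
      M.stateAt_mul_add hk b d hd (Nat.pos_of_ne_zero hb), hs]

theorem DFAO.tableState_eq (M : DFAO (Fin k) (Fin n) α) (hk : 2 ≤ k) (i : ℕ) :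
    tableState (k, M.table) i = M.stateAt hk i := by
  induction i using Nat.strong_induction_on with
  | _ i ih =>
    rw [tableState]
    split_ifs with h
    · obtain rfl : i = 0 := h.resolve_right (not_lt.2 hk)
      rw [M.stateAt_zero]
      rfl
    · have hpos : 0 < i := by omega
      have hmod : i % k < k := Nat.mod_lt _ (by omega)
      have hst := M.stateAt_mul_add hk (i / k) (i % k) hmod (by rwa [Nat.div_add_mod])
      rw [Nat.div_add_mod] at hst
      rw [ih _ (Nat.div_lt_self hpos (by omega)), hst]
      simp [tableStep, DFAO.table, hmod]

theorem DFAO.Generates.tableSlice_eq {M : DFAO (Fin k) (Fin n) α} {hk : 2 ≤ k} {x : ℕ → α}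
    (h : M.Generates hk x) (i m : ℕ) : tableSlice (k, M.table) i m = infWordSlice x i m := by
  rw [tableSlice, infWordSlice, ← List.filterMap_eq_map]
  congr 1
  funext j
  simp only [M.tableState_eq hk, Function.comp_apply, h (i + j)]
  simp [DFAO.table, DFAO.output, DFAO.stateAt]

theorem DFAO.Generates.mem_unboundedFactors_iff {M : DFAO (Fin k) (Fin n) α} {hk : 2 ≤ k}
    {x : ℕ → α} (h : M.Generates hk x) (w : List α) :
    w ∈ unboundedFactors (k, M.table) ↔ w ∈ primitiveUnbounded x := by
  have hx : ∀ a b, M.uniformState hk a = M.uniformState hk b → x a = x b := fun a b hab => by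
    rw [h a, h b]
    exact congrArg M.out (M.stateAt_eq_of_uniformState_eq hk hab).2
  have hlen : M.table.2.length = n := by simp [DFAO.table]
  rw [mem_primitiveUnbounded_iff hk (M.isUniformStates hk) hx, _root_.mem_unboundedFactors_iff]
  simp only [h.tableSlice_eq, hlen, Nat.card_eq_fintype_card, Fintype.card_option,
    Fintype.card_fin]

end Correctness

end Effective

/-- One algorithm, given `k` and the table of any base-`k` DFAO, outputs the list of all primitive
factors of unbounded exponent of the generated word; in particular they are finitely many. -/
theorem mainTheorem4 {α : Type*} [Primcodable α] :
    ∃ F : ℕ × (ℕ × List (List ℕ × α)) → List (List α), Computable F ∧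
      ∀ (k : ℕ) (hk : 2 ≤ k) (n : ℕ) (M : DFAO (Fin k) (Fin n) α) (x : ℕ → α),
        M.Generates hk x →
          (primitiveUnbounded x).Finite ∧
            ∀ w : List α, w ∈ F (k, M.table) ↔ w ∈ primitiveUnbounded x := by
  refine ⟨unboundedFactors, primrec_unboundedFactors.to_comp, fun k hk n M x h => ?_⟩
  refine ⟨?_, h.mem_unboundedFactors_iff⟩
  exact (List.finite_toSet (unboundedFactors (k, M.table))).subset fun w hw =>
    (h.mem_unboundedFactors_iff w).2 hw
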